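/- Let $a,q\in\mathbb{C}$ with $0<|q|<1$ and $a\neq 0$, and suppose that $aq^m\neq 1$ and $a\neq q^m$ for every integer $m\geq 1$. Write $(x;q)_n=\prod_{k=0}^{n-1}(1-xq^k)$, $(x;q)_\infty=\prod_{k=0}^{\infty}(1-xq^k)$ and $(x,y;q)_\infty=(x;q)_\infty (y;q)_\infty$. Then the three series below converge absolutely and \[ \sum_{n=0}^\infty \frac{(q^{n+1};q)_{n+1}\,q^n}{(aq;q)_n\,(q/a;q)_{n+1}} +(1-a)\sum_{n=0}^\infty a^{n+1}q^{n^2+n-1}(1-q^{n+1}) =\frac{1}{(aq,q/a;q)_\infty}\sum_{n=0}^\infty a^{3n}q^{3n^2-2n-1}(1-aq^{2n})(1-q^n+aq^{2n}). \] -/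

import Mathlib

/-- The finite `q`-shifted factorial `(a;q)_n = (1 - a)(1 - aq)⋯(1 - aq^(n-1))`. -/
noncomputable def qPoch (a q : ℂ) (n : ℕ) : ℂ :=
  ∏ k ∈ Finset.range n, (1 - a * q ^ k)

/-- The infinite `q`-shifted factorial `(a;q)_∞ = ∏_{k ≥ 0} (1 - aq^k)`, meant for `|q| < 1`. -/
noncomputable def qPochInf (a q : ℂ) : ℂ :=
  ∏' k : ℕ, (1 - a * q ^ k)

/-- For `|q| < 1` the infinite product defining `(a;q)_∞` converges. -/
theorem hasProd_qPochInf (a q : ℂ) (hq : ‖q‖ < 1) :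
    HasProd (fun k : ℕ => 1 - a * q ^ k) (qPochInf a q) := by
  have hs : Summable fun k : ℕ => ‖-(a * q ^ k)‖ := by
    simpa [norm_mul, norm_pow] using
      (summable_geometric_of_lt_one (norm_nonneg q) hq).mul_left ‖a‖
  have hm : Multipliable fun k : ℕ => 1 - a * q ^ k := by
    simpa [sub_eq_add_neg] using multipliable_one_add_of_summable hs
  exact hm.hasProd

/-- For `|q| < 1`, `(a;q)_∞` is the limit of `(a;q)_n` as `n → ∞`. -/
theorem tendsto_qPoch (a q : ℂ) (hq : ‖q‖ < 1) :
    Filter.Tendsto (fun n : ℕ => qPoch a q n) Filter.atTop (nhds (qPochInf a q)) :=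
  (hasProd_qPochInf a q hq).tendsto_prod_nat

/-! Multiplying the first series by $(aq,q/a;q)_\infty$ turns it into $\sum_n w_n/(q;q)_n$ with
$w_n$ = `clearedTerm` (`summand_eq`). The Bailey pair `sum_baileyAlpha` expands $1/(q;q)_n$, and
after interchanging sums (`bailey_transform`) each inner sum is an instance of Warnaar's series $W$,
for which $(q;q)_\infty W(a,b)=\theta(a)+\theta(b)-1$ with $\theta$ the partial theta function
(`warnaarSum_eq`).

The triple product trades $\theta(q^{r+2}/a)-1$ for $-\theta(aq^{-r-1})$ plus an infinite product.
The products sum to the second series of the theorem (`mul_warnaarSum_eq`). The differences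
$\theta(aq^{r+1})-\theta(aq^{-r-1})$ fold out of a bilateral sum with pentagonal exponents.
Expanding $\theta$ and interchanging sums leaves $\sum_n(-a)^nq^{\binom n2}(P(q^n)-P(q^{n+1}))$ with
$P$ = `pentTheta`. Since $P(1)=P(q)=(q;q)_\infty$, $P(q^2)=0$ and $P$ is quasi-periodic under
$y\mapsto yq^3$, grouping $n$ modulo 3 gives the right-hand series (`sum_pentTheta_sub`). -/

open Filter Topology

variable {q : ℂ}

/-! ### Recurrences, uniform bounds and limits of $q$-shifted factorials. -/

theorem qPoch_zero (x q : ℂ) : qPoch x q 0 = 1 := by simp [qPoch]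

theorem qPoch_succ (x q : ℂ) (n : ℕ) : qPoch x q (n + 1) = qPoch x q n * (1 - x * q ^ n) := by
  simp [qPoch, Finset.prod_range_succ]

theorem qPoch_add (x q : ℂ) (m n : ℕ) :
    qPoch x q (m + n) = qPoch x q m * qPoch (x * q ^ m) q n := by
  simp [qPoch, Finset.prod_range_add, pow_add, mul_assoc]

theorem qPoch_succ' (x q : ℂ) (n : ℕ) : qPoch x q (n + 1) = (1 - x) * qPoch (x * q) q n := by
  rw [add_comm, qPoch_add]; simp [qPoch]

theorem qPochInf_eq_mul (hq : ‖q‖ < 1) (x : ℂ) (n : ℕ) :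
    qPochInf x q = qPoch x q n * qPochInf (x * q ^ n) q := by
  have h1 := (tendsto_qPoch (x * q ^ n) q hq).const_mul (qPoch x q n)
  have h2 := (tendsto_qPoch x q hq).comp (tendsto_add_atTop_nat n)
  refine tendsto_nhds_unique (h2.congr fun m => ?_) h1
  rw [Function.comp_apply, add_comm, qPoch_add]

theorem qPochInf_eq_one_sub_mul (hq : ‖q‖ < 1) (x : ℂ) :
    qPochInf x q = (1 - x) * qPochInf (x * q) q := by
  have := qPochInf_eq_mul hq x 1
  simpa [qPoch] using this

/-- The bound is free of `n` and vanishes as $x\to0$, so it supplies both the uniform bounds and the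
limits to 1, even when the length of the product varies with $x$. -/
theorem norm_qPoch_sub_one_le (hq : ‖q‖ < 1) (x : ℂ) (n : ℕ) :
    ‖qPoch x q n - 1‖ ≤ Real.exp (‖x‖ / (1 - ‖q‖)) - 1 := by
  have h := (Finset.range n).norm_prod_one_add_sub_one_le fun k => -(x * q ^ k)
  simp only [← sub_eq_add_neg] at h
  refine h.trans (sub_le_sub_right (Real.exp_le_exp.2 ?_) 1)
  have hs := (hasSum_geometric_of_lt_one (norm_nonneg q) hq).mul_left ‖x‖
  rw [div_eq_mul_inv]
  refine le_trans (le_of_eq ?_) (sum_le_hasSum (Finset.range n) (fun k _ => by positivity) hs)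
  simp

theorem norm_qPochInf_sub_one_le (hq : ‖q‖ < 1) (x : ℂ) :
    ‖qPochInf x q - 1‖ ≤ Real.exp (‖x‖ / (1 - ‖q‖)) - 1 :=
  le_of_tendsto ((tendsto_qPoch x q hq).sub_const 1).norm
    (Eventually.of_forall fun n => norm_qPoch_sub_one_le hq x n)

theorem norm_le_exp_of_norm_sub_one_le {z : ℂ} {s : ℝ} (h : ‖z - 1‖ ≤ Real.exp s - 1) :
    ‖z‖ ≤ Real.exp s := by
  have := norm_add_le (z - 1) 1
  simp only [sub_add_cancel, norm_one] at this
  linarith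

theorem exists_norm_qPoch_le (hq : ‖q‖ < 1) (R : ℝ) :
    ∃ C : ℝ, 1 ≤ C ∧ ∀ x : ℂ, ‖x‖ ≤ R →
      (∀ n, ‖qPoch x q n‖ ≤ C) ∧ ‖qPochInf x q‖ ≤ C := by
  have h1 : 0 < 1 - ‖q‖ := by linarith
  refine ⟨Real.exp (|R| / (1 - ‖q‖)), Real.one_le_exp (by positivity), fun x hx => ?_⟩
  have hle : Real.exp (‖x‖ / (1 - ‖q‖)) ≤ Real.exp (|R| / (1 - ‖q‖)) :=
    Real.exp_le_exp.2 (div_le_div_of_nonneg_right (hx.trans (le_abs_self R)) h1.le)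
  exact ⟨fun n => (norm_le_exp_of_norm_sub_one_le (norm_qPoch_sub_one_le hq x n)).trans hle,
    (norm_le_exp_of_norm_sub_one_le (norm_qPochInf_sub_one_le hq x)).trans hle⟩

theorem tendsto_one_of_norm_sub_one_le (q : ℂ) {x g : ℕ → ℂ} (hx : Tendsto x atTop (𝓝 0))
    (h : ∀ n, ‖g n - 1‖ ≤ Real.exp (‖x n‖ / (1 - ‖q‖)) - 1) :
    Tendsto g atTop (𝓝 1) := by
  rw [tendsto_iff_norm_sub_tendsto_zero]
  have h0 : Tendsto (fun n => Real.exp (‖x n‖ / (1 - ‖q‖)) - 1) atTop (𝓝 0) := by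
    have := (Real.continuous_exp.tendsto _).comp (hx.norm.div_const (1 - ‖q‖))
    simpa using this.sub_const 1
  exact squeeze_zero (fun _ => norm_nonneg _) h h0

theorem tendsto_qPochInf_one (hq : ‖q‖ < 1) {x : ℕ → ℂ} (hx : Tendsto x atTop (𝓝 0)) :
    Tendsto (fun n => qPochInf (x n) q) atTop (𝓝 1) :=
  tendsto_one_of_norm_sub_one_le q hx fun n => norm_qPochInf_sub_one_le hq (x n)

theorem tendsto_qPoch_one (hq : ‖q‖ < 1) {x : ℕ → ℂ} (hx : Tendsto x atTop (𝓝 0)) (m : ℕ) :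
    Tendsto (fun n => qPoch (x n) q m) atTop (𝓝 1) :=
  tendsto_one_of_norm_sub_one_le q hx fun n => norm_qPoch_sub_one_le hq (x n) m

theorem qPochInf_ne_zero (hq : ‖q‖ < 1) {x : ℂ} (hx : ∀ k : ℕ, x * q ^ k ≠ 1) :
    qPochInf x q ≠ 0 := by
  have := tprod_one_add_ne_zero_of_summable (f := fun k : ℕ => -(x * q ^ k))
    (fun k h => hx k (by linear_combination -h))
    (by simpa using (summable_geometric_of_lt_one (norm_nonneg q) hq).mul_left ‖x‖)
  simpa [qPochInf, sub_eq_add_neg] using this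

theorem qPoch_ne_zero {x : ℂ} (hx : ∀ k : ℕ, x * q ^ k ≠ 1) (n : ℕ) : qPoch x q n ≠ 0 :=
  Finset.prod_ne_zero_iff.2 fun k _ h => hx k (by linear_combination -h)

theorem pow_succ_ne_one (hq : ‖q‖ < 1) (k : ℕ) : q ^ (k + 1) ≠ 1 := fun h => by
  have := congrArg norm h
  rw [norm_pow, norm_one] at this
  exact (pow_lt_one₀ (norm_nonneg q) hq k.succ_ne_zero).ne this

theorem mul_pow_self_ne_one (hq : ‖q‖ < 1) (k : ℕ) : q * q ^ k ≠ 1 := by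
  rw [← pow_succ']; exact pow_succ_ne_one hq k

theorem qPoch_self_ne_zero (hq : ‖q‖ < 1) (n : ℕ) : qPoch q q n ≠ 0 :=
  qPoch_ne_zero (mul_pow_self_ne_one hq) n

theorem qPochInf_self_ne_zero (hq : ‖q‖ < 1) : qPochInf q q ≠ 0 :=
  qPochInf_ne_zero hq (mul_pow_self_ne_one hq)

theorem exists_norm_inv_qPoch_self_le (hq : ‖q‖ < 1) :
    ∃ C : ℝ, 1 ≤ C ∧ ∀ n, ‖(qPoch q q n)⁻¹‖ ≤ C := by
  have h := ((tendsto_qPoch q q hq).inv₀ (qPochInf_self_ne_zero hq)).norm.bddAbove_range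
  obtain ⟨C, hC⟩ := h
  have h0 : ∀ n, ‖(qPoch q q n)⁻¹‖ ≤ C := fun n => hC ⟨n, rfl⟩
  exact ⟨C, by simpa [qPoch_zero] using h0 0, h0⟩

theorem norm_pow_le_one (hq : ‖q‖ < 1) (n : ℕ) : ‖q ^ n‖ ≤ 1 := by
  rw [norm_pow]; exact pow_le_one₀ (norm_nonneg q) hq.le

theorem norm_mul_pow_le (hq : ‖q‖ < 1) (x : ℂ) (n : ℕ) : ‖x * q ^ n‖ ≤ ‖x‖ := by
  rw [norm_mul]; exact mul_le_of_le_one_right (norm_nonneg x) (norm_pow_le_one hq n)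

theorem tendsto_mul_pow_zero (hq : ‖q‖ < 1) (x : ℂ) :
    Tendsto (fun n : ℕ => x * q ^ n) atTop (𝓝 0) := by
  simpa using (tendsto_pow_atTop_nhds_zero_of_norm_lt_one hq).const_mul x

/-! ### Partial theta functions and their $q$-series form. -/

/-- The summand `x ^ n * q ^ (n choose 2)` decays faster than any geometric sequence. -/
theorem summable_norm_pow_mul_pow_choose (hq : ‖q‖ < 1) (x : ℂ) :
    Summable fun n : ℕ => ‖x ^ n * q ^ n.choose 2‖ := by
  refine Summable.norm (summable_of_ratio_norm_eventually_le (r := 1 / 2) (by norm_num) ?_)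
  have h := (tendsto_mul_pow_zero hq x).norm.eventually_le_const
    (show ‖(0 : ℂ)‖ < 1 / 2 by norm_num)
  filter_upwards [h] with n hn
  have : x ^ (n + 1) * q ^ (n + 1).choose 2 = x * q ^ n * (x ^ n * q ^ n.choose 2) := by
    rw [Nat.choose_succ_succ' n 1, Nat.choose_one_right]; ring
  rw [this, norm_mul]
  exact mul_le_mul_of_nonneg_right hn (norm_nonneg _)

/-- The partial theta function `∑ (-x)^n q^(n(n-1)/2)`. -/
noncomputable def partialTheta (q x : ℂ) : ℂ := ∑' n : ℕ, (-x) ^ n * q ^ n.choose 2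

theorem partialTheta_eq (hq : ‖q‖ < 1) (x : ℂ) :
    partialTheta q x = 1 - x * partialTheta q (x * q) := by
  unfold partialTheta
  rw [(summable_norm_pow_mul_pow_choose hq (-x)).of_norm.tsum_eq_zero_add, ← tsum_mul_left,
    sub_eq_add_neg, ← tsum_neg]
  congr 1
  · simp
  · congr 1; ext n
    rw [Nat.choose_succ_succ' n 1, Nat.choose_one_right, neg_mul_eq_neg_mul x q, mul_pow]; ring

theorem exists_norm_partialTheta_le (hq : ‖q‖ < 1) (R : ℝ) :
    ∃ C : ℝ, ∀ x : ℂ, ‖x‖ ≤ R → ‖partialTheta q x‖ ≤ C := by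
  have hs := summable_norm_pow_mul_pow_choose hq (R : ℂ)
  refine ⟨_, fun x hx => tsum_of_norm_bounded hs.hasSum fun n => ?_⟩
  rw [norm_mul, norm_mul, norm_pow, norm_pow _ n, norm_neg]
  gcongr
  simpa using hx.trans (le_abs_self R)

/-- Uniqueness principle for $q$-difference equations: iteration produces the factor
$(-x)^nq^{\binom n2}\to0$ against a bounded value of `D`. -/
theorem eq_zero_of_eq_neg_mul (hq : ‖q‖ < 1) {D : ℂ → ℂ} (h : ∀ x, D x = -x * D (x * q))
    {x : ℂ} {C : ℝ} (hC : ∀ y, ‖y‖ ≤ ‖x‖ → ‖D y‖ ≤ C) : D x = 0 := by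
  have key : ∀ n : ℕ, D x = (-x) ^ n * q ^ n.choose 2 * D (x * q ^ n) := by
    intro n
    induction n with
    | zero => simp
    | succ n ih =>
      rw [ih, h (x * q ^ n), Nat.choose_succ_succ' n 1, Nat.choose_one_right, mul_assoc x, ← pow_succ]
      ring
  have h0 : Tendsto (fun n : ℕ => ‖(-x) ^ n * q ^ n.choose 2‖ * C) atTop (𝓝 0) := by
    simpa using (summable_norm_pow_mul_pow_choose hq (-x)).tendsto_atTop_zero.mul_const C
  refine norm_le_zero_iff.1 (ge_of_tendsto' h0 fun n => ?_)
  rw [key n, norm_mul]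
  exact mul_le_mul_of_nonneg_left (hC _ (norm_mul_pow_le hq x n)) (norm_nonneg _)

theorem tsum_of_telescoping {h z : ℕ → ℂ} {l : ℂ} (hs : Summable h)
    (hz : ∀ n, h n = z (n + 1) - z n) (hl : Tendsto z atTop (𝓝 l)) : ∑' n, h n = l - z 0 := by
  refine HasSum.tsum_eq ((hs.hasSum_iff_tendsto_nat).2 ?_)
  have : (fun n => ∑ i ∈ Finset.range n, h i) = fun n => z n - z 0 := by
    ext n; rw [← Finset.sum_range_sub]; exact Finset.sum_congr rfl fun i _ => hz i
  rw [this]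
  exact hl.sub_const _

theorem summable_of_norm_le_mul_pow (hq : ‖q‖ < 1) {h : ℕ → ℂ} {C : ℝ}
    (hC : ∀ n, ‖h n‖ ≤ C * ‖q‖ ^ n) : Summable h :=
  Summable.of_norm_bounded ((summable_geometric_of_lt_one (norm_nonneg q) hq).mul_left C) hC

theorem exists_norm_pow_div_mul_le (hq : ‖q‖ < 1) (R : ℝ) :
    ∃ C : ℝ, 0 ≤ C ∧ ∀ x, ‖x‖ ≤ R → ∀ n : ℕ,
      ‖q ^ n / qPoch q q n * qPochInf (x * q ^ n) q‖ ≤ C * ‖q‖ ^ n := by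
  obtain ⟨C₁, h1, hC₁⟩ := exists_norm_inv_qPoch_self_le hq
  obtain ⟨C₂, h2, hC₂⟩ := exists_norm_qPoch_le hq R
  refine ⟨C₁ * C₂, by positivity, fun x hx n => ?_⟩
  have e1 := hC₁ n
  have e2 := (hC₂ (x * q ^ n) ((norm_mul_pow_le hq x n).trans hx)).2
  rw [div_eq_mul_inv, norm_mul, norm_mul, norm_pow]
  calc ‖q‖ ^ n * ‖(qPoch q q n)⁻¹‖ * ‖qPochInf (x * q ^ n) q‖ ≤ ‖q‖ ^ n * C₁ * C₂ := by gcongr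
    _ = _ := by ring

theorem summable_pow_div_mul (hq : ‖q‖ < 1) (x : ℂ) :
    Summable fun n : ℕ => q ^ n / qPoch q q n * qPochInf (x * q ^ n) q := by
  obtain ⟨C, -, hC⟩ := exists_norm_pow_div_mul_le hq ‖x‖
  exact summable_of_norm_le_mul_pow hq (hC x le_rfl)

/-- Both sides satisfy $F(x)+xF(xq)=1$, the left one by telescoping, so their difference falls under
`eq_zero_of_eq_neg_mul`. -/
theorem tsum_pow_div_mul_qPochInf (hq : ‖q‖ < 1) (x : ℂ) :
    qPochInf q q * ∑' n : ℕ, q ^ n / qPoch q q n * qPochInf (x * q ^ n) q = partialTheta q x := by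
  set Y : ℂ → ℂ := fun x => ∑' n : ℕ, q ^ n / qPoch q q n * qPochInf (x * q ^ n) q with hY
  have hP := qPochInf_self_ne_zero hq
  have hfun : ∀ x, Y x + x * Y (x * q) = 1 / qPochInf q q := by
    intro x
    have hz : Tendsto (fun n : ℕ => (1 - q ^ n) * qPochInf (x * q ^ n) q / qPoch q q n) atTop
        (𝓝 ((1 - 0) * 1 / qPochInf q q)) :=
      (((tendsto_pow_atTop_nhds_zero_of_norm_lt_one hq).const_sub 1).mul
        (tendsto_qPochInf_one hq (tendsto_mul_pow_zero hq x))).div (tendsto_qPoch q q hq) hP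
    rw [hY]
    simp only
    rw [← tsum_mul_left, ← (summable_pow_div_mul hq x).tsum_add
      ((summable_pow_div_mul hq (x * q)).mul_left x)]
    rw [tsum_of_telescoping ((summable_pow_div_mul hq x).add
      ((summable_pow_div_mul hq (x * q)).mul_left x)) (fun n => ?_) hz]
    · simp
    · have h1 := qPoch_self_ne_zero hq n
      have h2 := qPoch_self_ne_zero hq (n + 1)
      have h3 : qPoch q q (n + 1) = qPoch q q n * (1 - q ^ (n + 1)) := by rw [qPoch_succ]; ring
      have h4 : 1 - q ^ (n + 1) ≠ 0 := fun h => by simp [h3, h] at h2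
      have h5 : qPochInf (x * q ^ n) q = (1 - x * q ^ n) * qPochInf (x * q ^ (n + 1)) q := by
        rw [qPochInf_eq_one_sub_mul hq (x * q ^ n)]; ring_nf
      rw [h3, h5, show x * q * q ^ n = x * q ^ (n + 1) by ring]
      field_simp
      ring
  have hD : qPochInf q q * Y x - partialTheta q x = 0 := by
    obtain ⟨C₁, h1, hC₁⟩ := exists_norm_pow_div_mul_le hq ‖x‖
    obtain ⟨C₂, hC₂⟩ := exists_norm_partialTheta_le hq ‖x‖
    refine eq_zero_of_eq_neg_mul (D := fun x => qPochInf q q * Y x - partialTheta q x) hq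
      (fun x => ?_) (C := ‖qPochInf q q‖ * (C₁ * (1 - ‖q‖)⁻¹) + C₂)
      fun y hy => ?_
    · have := hfun x
      field_simp at this
      rw [partialTheta_eq hq x]
      linear_combination this
    · refine (norm_sub_le _ _).trans (add_le_add ?_ (hC₂ y hy))
      rw [norm_mul]
      gcongr
      exact tsum_of_norm_bounded ((hasSum_geometric_of_lt_one (norm_nonneg q) hq).mul_left C₁)
        (hC₁ y hy)
  exact sub_eq_zero.1 hD

/-! ### The contiguous series and its independence of $a$. -/

/-- The auxiliary series kernel `q^(n+1) (c q^(n+1);q)_n / (q;q)_(n+1)`. -/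
noncomputable def warnaarCoeff (q c : ℂ) (n : ℕ) : ℂ :=
  q ^ (n + 1) * qPoch (c * q ^ (n + 1)) q n / qPoch q q (n + 1)

theorem exists_norm_warnaarCoeff_le (hq : ‖q‖ < 1) (R : ℝ) :
    ∃ C : ℝ, 0 ≤ C ∧ ∀ c, ‖c‖ ≤ R → ∀ n : ℕ, ‖warnaarCoeff q c n‖ ≤ C * ‖q‖ ^ n := by
  obtain ⟨C₁, h1, hC₁⟩ := exists_norm_inv_qPoch_self_le hq
  obtain ⟨C₂, h2, hC₂⟩ := exists_norm_qPoch_le hq R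
  refine ⟨C₁ * C₂, by positivity, fun c hc n => ?_⟩
  have e1 := hC₁ (n + 1)
  have e2 := (hC₂ (c * q ^ (n + 1)) ((norm_mul_pow_le hq c (n + 1)).trans hc)).1 n
  have e3 : ‖q‖ ^ (n + 1) ≤ ‖q‖ ^ n := pow_le_pow_of_le_one (norm_nonneg q) hq.le n.le_succ
  rw [warnaarCoeff, div_eq_mul_inv, norm_mul, norm_mul, norm_pow]
  calc _ ≤ ‖q‖ ^ n * C₂ * C₁ := by gcongr
    _ = _ := by ring

theorem exists_norm_warnaar_le (hq : ‖q‖ < 1) (R : ℝ) :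
    ∃ C : ℝ, 0 ≤ C ∧ ∀ c x y : ℂ, ‖c‖ ≤ R → ‖x‖ ≤ R → ‖y‖ ≤ R → ∀ n i j : ℕ,
      ‖warnaarCoeff q c n * qPochInf (x * q ^ i) q * qPochInf (y * q ^ j) q‖ ≤ C * ‖q‖ ^ n := by
  obtain ⟨C₁, h1, hC₁⟩ := exists_norm_warnaarCoeff_le hq R
  obtain ⟨C₂, h2, hC₂⟩ := exists_norm_qPoch_le hq R
  refine ⟨C₁ * C₂ * C₂, by positivity, fun c x y hc hx hy n i j => ?_⟩
  have e1 := hC₁ c hc n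
  have e2 := (hC₂ (x * q ^ i) ((norm_mul_pow_le hq x i).trans hx)).2
  have e3 := (hC₂ (y * q ^ j) ((norm_mul_pow_le hq y j).trans hy)).2
  rw [norm_mul, norm_mul]
  calc _ ≤ C₁ * ‖q‖ ^ n * C₂ * C₂ := by gcongr
    _ = _ := by ring

theorem summable_warnaar (hq : ‖q‖ < 1) (c x y : ℂ) (i j : ℕ) :
    Summable fun n : ℕ =>
      warnaarCoeff q c n * qPochInf (x * q ^ (n + i)) q * qPochInf (y * q ^ (n + j)) q := by
  obtain ⟨C, -, hC⟩ := exists_norm_warnaar_le hq (max ‖c‖ (max ‖x‖ ‖y‖))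
  exact summable_of_norm_le_mul_pow hq fun n => hC c x y (by simp) (by simp) (by simp) n _ _

/-- The summand of the contiguous series in Warnaar's identity. -/
noncomputable def contigTerm (q a b : ℂ) (n : ℕ) : ℂ :=
  warnaarCoeff q (a * b) n * qPochInf (a * q ^ (n + 2)) q * qPochInf (b * q ^ (n + 1)) q *
    (1 + a - a * q ^ (n + 1) - a * b * q ^ n)

theorem exists_norm_contigTerm_le (hq : ‖q‖ < 1) (R : ℝ) :
    ∃ C : ℝ, ∀ a b : ℂ, ‖a‖ ≤ R → ‖b‖ ≤ R → ∀ n, ‖contigTerm q a b n‖ ≤ C * ‖q‖ ^ n := by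
  obtain ⟨C, h0, hC⟩ := exists_norm_warnaar_le hq (max R (R * R))
  refine ⟨C * (1 + R + R + R * R), fun a b ha hb n => ?_⟩
  have hR : 0 ≤ R := (norm_nonneg a).trans ha
  have hab : ‖a * b‖ ≤ R * R := by rw [norm_mul]; gcongr
  have e1 := hC (a * b) a b (hab.trans (le_max_right _ _)) (ha.trans (le_max_left _ _))
    (hb.trans (le_max_left _ _)) n (n + 2) (n + 1)
  have e2 : ‖1 + a - a * q ^ (n + 1) - a * b * q ^ n‖ ≤ 1 + R + R + R * R := by
    refine (norm_sub_le _ _).trans (add_le_add ((norm_sub_le _ _).trans (add_le_add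
      ((norm_add_le _ _).trans (add_le_add norm_one.le ha)) ?_)) ?_)
    · exact (norm_mul_pow_le hq _ _).trans ha
    · exact (norm_mul_pow_le hq _ _).trans hab
  rw [contigTerm, norm_mul]
  calc _ ≤ C * ‖q‖ ^ n * (1 + R + R + R * R) := by gcongr
    _ = _ := by ring

theorem summable_contigTerm (hq : ‖q‖ < 1) (a b : ℂ) : Summable (contigTerm q a b) := by
  obtain ⟨C, hC⟩ := exists_norm_contigTerm_le hq (max ‖a‖ ‖b‖)
  exact summable_of_norm_le_mul_pow hq (hC a b (le_max_left _ _) (le_max_right _ _))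

/-- The contiguous series in Warnaar's identity. -/
noncomputable def contigSum (q a b : ℂ) : ℂ :=
  qPochInf (a * q) q * qPochInf b q + ∑' n, contigTerm q a b n

/-- The right side is $z_{n+1}-z_n$, so the change under $a\mapsto aq$ telescopes. -/
theorem contigTerm_sub (hq : ‖q‖ < 1) (a b : ℂ) (n : ℕ) :
    contigTerm q a b n - contigTerm q (a * q) b n =
      -a * q ^ (n + 2) * qPoch (a * b * q ^ (n + 2)) q (n + 1) / qPoch q q (n + 1) *
        qPochInf (a * q ^ (n + 3)) q * qPochInf (b * q ^ (n + 1)) q -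
      -a * q ^ (n + 1) * qPoch (a * b * q ^ (n + 1)) q n / qPoch q q n *
        qPochInf (a * q ^ (n + 2)) q * qPochInf (b * q ^ n) q := by
  have h1 := qPoch_self_ne_zero hq n
  have h2 := qPoch_self_ne_zero hq (n + 1)
  have h3 : qPoch q q (n + 1) = qPoch q q n * (1 - q ^ (n + 1)) := by rw [qPoch_succ]; ring
  have h4 : 1 - q ^ (n + 1) ≠ 0 := fun h => by simp [h3, h] at h2
  have h5 : qPochInf (b * q ^ n) q = (1 - b * q ^ n) * qPochInf (b * q ^ (n + 1)) q := by
    rw [qPochInf_eq_one_sub_mul hq (b * q ^ n)]; ring_nf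
  have h6 : qPochInf (a * q ^ (n + 2)) q =
      (1 - a * q ^ (n + 2)) * qPochInf (a * q ^ (n + 3)) q := by
    rw [qPochInf_eq_one_sub_mul hq (a * q ^ (n + 2))]; ring_nf
  set c := a * b with hc
  unfold contigTerm warnaarCoeff
  rw [show a * q * b = c * q by rw [hc]; ring, show c * q * q ^ (n + 1) = c * q ^ (n + 2) by ring,
    show a * q * q ^ (n + 2) = a * q ^ (n + 3) by ring, ← hc, h5, h6, h3]
  -- For $n=m+1$ the three finite factorials share $(cq^{m+3};q)_m$; at $n=0$ that common factor
  -- would have length $-1$.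
  cases n with
  | zero =>
    simp only [qPoch_zero, qPoch_succ]
    field_simp
    rw [hc]
    ring
  | succ m =>
    have e1 : qPoch (c * q ^ (m + 1 + 1)) q (m + 1) =
        (1 - c * q ^ (m + 2)) * qPoch (c * q ^ (m + 3)) q m := by
      rw [qPoch_succ']; ring_nf
    have e2 : qPoch (c * q ^ (m + 1 + 2)) q (m + 1) =
        qPoch (c * q ^ (m + 3)) q m * (1 - c * q ^ (2 * m + 3)) := by
      rw [qPoch_succ]; ring_nf
    have e3 : qPoch (c * q ^ (m + 1 + 2)) q (m + 1 + 1) =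
        qPoch (c * q ^ (m + 3)) q m * (1 - c * q ^ (2 * m + 3)) * (1 - c * q ^ (2 * m + 4)) := by
      rw [qPoch_succ, e2]; ring_nf
    rw [e1, e2, e3]
    field_simp
    rw [hc]
    ring

/-- The boundary term $z_0=-aq\,(aq^2;q)_\infty(b;q)_\infty$ of the telescoping sum cancels the
change in the leading product. -/
theorem contigSum_mul_left (hq : ‖q‖ < 1) (a b : ℂ) :
    contigSum q (a * q) b = contigSum q a b := by
  have hs := (summable_contigTerm hq a b).sub (summable_contigTerm hq (a * q) b)
  have hz : Tendsto (fun n : ℕ => -a * q ^ (n + 1) * qPoch (a * b * q ^ (n + 1)) q n /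
      qPoch q q n * qPochInf (a * q ^ (n + 2)) q * qPochInf (b * q ^ n) q) atTop (𝓝 0) := by
    have h1 : Tendsto (fun n : ℕ => a * b * q ^ (n + 1)) atTop (𝓝 0) :=
      (tendsto_mul_pow_zero hq (a * b)).comp (tendsto_add_atTop_nat 1)
    have h2 : Tendsto (fun n : ℕ => -a * q ^ (n + 1)) atTop (𝓝 0) :=
      (tendsto_mul_pow_zero hq (-a)).comp (tendsto_add_atTop_nat 1)
    have h3 : Tendsto (fun n : ℕ => qPoch (a * b * q ^ (n + 1)) q n) atTop (𝓝 1) :=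
      tendsto_one_of_norm_sub_one_le q h1 fun n => norm_qPoch_sub_one_le hq _ n
    have h4 := tendsto_qPochInf_one hq ((tendsto_mul_pow_zero hq a).comp (tendsto_add_atTop_nat 2))
    have h5 := tendsto_qPochInf_one hq (tendsto_mul_pow_zero hq b)
    simpa using (((h2.mul h3).div (tendsto_qPoch q q hq) (qPochInf_self_ne_zero hq)).mul h4).mul h5
  have key := tsum_of_telescoping hs (fun n => contigTerm_sub hq a b n) hz
  rw [(summable_contigTerm hq a b).tsum_sub (summable_contigTerm hq (a * q) b)] at key
  have h0 : qPochInf (a * q) q = (1 - a * q) * qPochInf (a * q ^ 2) q := by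
    rw [qPochInf_eq_one_sub_mul hq (a * q)]; ring_nf
  simp only [qPoch_zero] at key
  unfold contigSum
  rw [show a * q * q = a * q ^ 2 by ring, h0]
  simp only [zero_add, pow_one, pow_zero, mul_one, div_one] at key
  linear_combination -key

/-- Invariance under $a\mapsto aq$ allows $a$ to be replaced by $aq^N\to0$; dominated convergence
leaves the series of `tsum_pow_div_mul_qPochInf`. -/
theorem contigSum_eq (hq : ‖q‖ < 1) (a b : ℂ) :
    qPochInf q q * contigSum q a b = partialTheta q b := by
  have hN : ∀ N : ℕ, contigSum q (a * q ^ N) b = contigSum q a b := by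
    intro N
    induction N with
    | zero => simp
    | succ N ih => rw [← ih, ← contigSum_mul_left hq (a * q ^ N), pow_succ, mul_assoc]
  have ha := tendsto_mul_pow_zero hq a
  have hlim : Tendsto (fun N : ℕ => contigSum q (a * q ^ N) b) atTop
      (𝓝 (1 * qPochInf b q + ∑' n : ℕ, q ^ (n + 1) / qPoch q q (n + 1) *
        qPochInf (b * q ^ (n + 1)) q)) := by
    obtain ⟨C, hC⟩ := exists_norm_contigTerm_le hq (max ‖a‖ ‖b‖)
    refine Tendsto.add (Tendsto.mul_const _ (tendsto_qPochInf_one hq (by simpa using ha.mul_const q)))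
      (tendsto_tsum_of_dominated_convergence
        ((summable_geometric_of_lt_one (norm_nonneg q) hq).mul_left C) (fun n => ?_)
        (Eventually.of_forall fun N n =>
          hC _ _ ((norm_mul_pow_le hq a N).trans (le_max_left _ _)) (le_max_right _ _) n))
    have h1 := tendsto_qPoch_one hq (x := fun N => a * q ^ N * b * q ^ (n + 1))
      (by simpa using (ha.mul_const b).mul_const (q ^ (n + 1))) n
    have h2 := tendsto_qPochInf_one hq (x := fun N => a * q ^ N * q ^ (n + 2))
      (by simpa using ha.mul_const (q ^ (n + 2)))
    have h3 : Tendsto (fun N => 1 + a * q ^ N - a * q ^ N * q ^ (n + 1) - a * q ^ N * b * q ^ n)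
        atTop (𝓝 (1 + 0 - 0 * q ^ (n + 1) - 0 * b * q ^ n)) :=
      ((ha.const_add 1).sub (ha.mul_const _)).sub ((ha.mul_const _).mul_const _)
    have h4 := ((((h1.const_mul (q ^ (n + 1))).div_const (qPoch q q (n + 1))).mul h2).mul_const
      (qPochInf (b * q ^ (n + 1)) q)).mul h3
    unfold contigTerm warnaarCoeff
    simpa using h4
  simp only [hN] at hlim
  rw [tendsto_nhds_unique tendsto_const_nhds hlim, ← tsum_pow_div_mul_qPochInf hq b,
    (summable_pow_div_mul hq b).tsum_eq_zero_add]
  simp [qPoch_zero]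

/-! ### Warnaar's identity and the Jacobi triple product. -/

/-- The series of Warnaar's generalisation of the Jacobi triple product. -/
noncomputable def warnaarSum (q a b : ℂ) : ℂ :=
  qPochInf a q * qPochInf b q + (1 - a * b / q) * ∑' n : ℕ,
    warnaarCoeff q (a * b) n * qPochInf (a * q ^ (n + 1)) q * qPochInf (b * q ^ (n + 1)) q

theorem warnaarSum_comm (q a b : ℂ) : warnaarSum q a b = warnaarSum q b a := by
  unfold warnaarSum
  rw [mul_comm b a, mul_comm (qPochInf b q)]
  congr 3; ext n; ring

/-- The move $(a,b)\mapsto(aq,b/q)$ fixes $ab$, hence the kernel, and termwise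
$(1-aq^{n+1})+a(1-bq^n)$ is the last factor of `contigTerm`. -/
theorem warnaarSum_add (hq0 : q ≠ 0) (hq : ‖q‖ < 1) (a b : ℂ) :
    warnaarSum q a b + a * warnaarSum q (a * q) (b / q) =
      (1 - a * b / q) * contigSum q a b := by
  have hc : a * q * (b / q) = a * b := by field_simp
  have hb : qPochInf (b / q) q = (1 - b / q) * qPochInf b q := by
    rw [qPochInf_eq_one_sub_mul hq (b / q), div_mul_cancel₀ b hq0]
  unfold warnaarSum contigSum
  rw [hc, hb, qPochInf_eq_one_sub_mul hq a]
  have hs1 := summable_warnaar hq (a * b) a b 1 1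
  have hs2 : Summable fun n : ℕ => warnaarCoeff q (a * b) n *
      qPochInf (a * q * q ^ (n + 1)) q * qPochInf (b / q * q ^ (n + 1)) q :=
    summable_warnaar hq (a * b) (a * q) (b / q) 1 1
  have key : ∑' n, contigTerm q a b n = ∑' n : ℕ, warnaarCoeff q (a * b) n *
      qPochInf (a * q ^ (n + 1)) q * qPochInf (b * q ^ (n + 1)) q + a * ∑' n : ℕ,
      warnaarCoeff q (a * b) n * qPochInf (a * q * q ^ (n + 1)) q *
        qPochInf (b / q * q ^ (n + 1)) q := by
    rw [← tsum_mul_left, ← hs1.tsum_add (hs2.mul_left a)]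
    congr 1; ext n
    have h1 : qPochInf (a * q ^ (n + 1)) q =
        (1 - a * q ^ (n + 1)) * qPochInf (a * q ^ (n + 2)) q := by
      rw [qPochInf_eq_one_sub_mul hq (a * q ^ (n + 1))]; ring_nf
    have h2 : qPochInf (b / q * q ^ (n + 1)) q =
        (1 - b * q ^ n) * qPochInf (b * q ^ (n + 1)) q := by
      rw [show b / q * q ^ (n + 1) = b * q ^ n by rw [pow_succ]; field_simp,
        qPochInf_eq_one_sub_mul hq (b * q ^ n)]
      ring_nf
    rw [contigTerm, h1, h2, show a * q * q ^ (n + 1) = a * q ^ (n + 2) by ring]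
    ring
  rw [key]
  field_simp
  ring

/-- Warnaar's generalisation of the Jacobi triple product identity. -/
theorem warnaarSum_eq (hq0 : q ≠ 0) (hq : ‖q‖ < 1) {a b : ℂ} (hab : a * b ≠ q) :
    qPochInf q q * warnaarSum q a b = partialTheta q a + partialTheta q b - 1 := by
  set T : ℂ → ℂ → ℂ := fun a b =>
    qPochInf q q * warnaarSum q a b - (partialTheta q a + partialTheta q b - 1) with hT
  have hcomm : ∀ a b, T a b = T b a := fun a b => by simp only [hT, warnaarSum_comm q a b]; ring
  have hstep : ∀ a b, T a b + a * T (a * q) (b / q) = 0 := by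
    intro a b
    have h1 := partialTheta_eq hq a
    have h2 := partialTheta_eq hq (b / q)
    rw [div_mul_cancel₀ b hq0] at h2
    have h3 := contigSum_eq hq a b
    have h4 := warnaarSum_add hq0 hq a b
    simp only [hT]
    rw [h1, h2]
    linear_combination qPochInf q q * h4 + (1 - a * b / q) * h3
  -- By symmetry the step at $(b/q,aq)$ leads back from $T(aq,b/q)$ to $T(a,b)$, so the two steps
  -- together give $(1-ab/q)\,T(a,b)=0$.
  have h1 := hstep a b
  have h2 := hstep (b / q) (a * q)
  rw [div_mul_cancel₀ b hq0, mul_div_cancel_right₀ a hq0, hcomm (b / q), hcomm b] at h2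
  have h3 : (1 - a * b / q) * T a b = 0 := by linear_combination h1 - a * h2
  have h4 : 1 - a * b / q ≠ 0 := fun h => hab (by field_simp at h; linear_combination -h)
  exact sub_eq_zero.1 ((mul_eq_zero.1 h3).resolve_left h4)

/-- The Jacobi triple product identity. -/
theorem jacobi_triple_product (hq : ‖q‖ < 1) {a : ℂ} (ha : a ≠ 0) :
    qPochInf q q * (qPochInf a q * qPochInf (q / a) q) =
      partialTheta q a + partialTheta q (q / a) - 1 := by
  have h1 := contigSum_eq hq a (q / a)
  have h2 := contigSum_eq hq (1 / a) (a * q)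
  -- Here $ab=q$, the case excluded from `warnaarSum_eq`. The two contiguous series are
  -- proportional, so subtracting $a$ times the second leaves only $(1-a)(aq,q/a;q)_\infty$.
  have hterm : ∀ n, contigTerm q a (q / a) n = a * contigTerm q (1 / a) (a * q) n := by
    intro n
    unfold contigTerm
    rw [show a * (q / a) = q by field_simp, show 1 / a * (a * q) = q by field_simp,
      show a * q * q ^ (n + 1) = a * q ^ (n + 2) by ring,
      show q / a * q ^ (n + 1) = 1 / a * q ^ (n + 2) by ring]
    field_simp
    ring
  unfold contigSum at h1 h2
  simp only [hterm, tsum_mul_left] at h1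
  rw [partialTheta_eq hq a, ← h1, ← h2, qPochInf_eq_one_sub_mul hq a,
    show 1 / a * q = q / a by ring]
  ring

/-! ### The Bailey pair and the Bailey transform. -/

/-- The `α`-sequence of the Bailey pair relative to `q^2` with `β_n = 1 / (q;q)_n`, rescaled. -/
noncomputable def baileyAlpha (q : ℂ) (r : ℕ) : ℂ :=
  (-1) ^ r * q ^ (3 * (r + 1).choose 2) * (1 - q ^ (2 * r + 2)) * (1 - q ^ (r + 1))

/-- The certificate of the telescoping proof of `sum_baileyAlpha`. -/
noncomputable def baileyCert (q : ℂ) (r d : ℕ) : ℂ :=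
  -((-1) ^ r * q ^ (3 * (r + 1).choose 2) * q ^ d * (1 - q ^ r) * (1 - q ^ (r + 1)) /
    (qPoch q q d * qPoch q q (d + 2 * r + 1)))

theorem qPoch_self_succ (q : ℂ) (n : ℕ) :
    qPoch q q (n + 1) = qPoch q q n * (1 - q ^ (n + 1)) := by
  rw [qPoch_succ, ← pow_succ']

theorem one_sub_pow_succ_ne_zero (hq : ‖q‖ < 1) (k : ℕ) : 1 - q ^ (k + 1) ≠ 0 :=
  fun h => pow_succ_ne_one hq k (by linear_combination -h)

/-- With $n=r+d$ this is a creative-telescoping relation for $(1-q^{n+1})S_{n+1}=S_n$; using $d$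
avoids truncated subtraction. -/
theorem baileyAlpha_telescoping (hq : ‖q‖ < 1) (r d : ℕ) :
    (1 - q ^ (r + d + 1)) * (baileyAlpha q r / (qPoch q q (d + 1) * qPoch q q (d + 2 * r + 3))) -
      baileyAlpha q r / (qPoch q q d * qPoch q q (d + 2 * r + 2)) =
    baileyCert q (r + 1) d - baileyCert q r (d + 1) := by
  have h1 := qPoch_self_ne_zero hq d
  have h2 := qPoch_self_ne_zero hq (d + 2 * r + 2)
  have h3 := one_sub_pow_succ_ne_zero hq d
  have h4 := one_sub_pow_succ_ne_zero hq (d + 2 * r + 2)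
  unfold baileyAlpha baileyCert
  rw [show d + 1 + 2 * r + 1 = d + 2 * r + 2 by ring,
    show d + 2 * (r + 1) + 1 = d + 2 * r + 2 + 1 by ring, qPoch_self_succ q d,
    show d + 2 * r + 3 = d + 2 * r + 2 + 1 by ring, qPoch_self_succ q (d + 2 * r + 2),
    Nat.choose_succ_succ' (r + 1) 1, Nat.choose_one_right]
  field_simp
  ring

theorem sum_baileyAlpha_range (hq : ‖q‖ < 1) (n : ℕ) :
    ∑ r ∈ Finset.range (n + 1), baileyAlpha q r / (qPoch q q (n - r) * qPoch q q (n + r + 2)) =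
      1 / qPoch q q n := by
  induction n with
  | zero =>
    have h1 := one_sub_pow_succ_ne_zero hq 0
    have h2 := one_sub_pow_succ_ne_zero hq 1
    simp only [zero_add, pow_one] at h1
    simp [baileyAlpha, qPoch, Finset.prod_range_succ, ← pow_two]
    field_simp
  | succ n ih =>
    have h1 := qPoch_self_ne_zero hq n
    have h2 := one_sub_pow_succ_ne_zero hq n
    have htel : (1 - q ^ (n + 1)) * ∑ r ∈ Finset.range (n + 1),
        baileyAlpha q r / (qPoch q q (n + 1 - r) * qPoch q q (n + 1 + r + 2)) -
        1 / qPoch q q n = baileyCert q (n + 1) 0 := by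
      rw [← ih, Finset.mul_sum, ← Finset.sum_sub_distrib]
      -- The lower boundary term vanishes because of the factor $1-q^r$ at $r=0$.
      have h0 : baileyCert q (n + 1) 0 =
          baileyCert q (n + 1) (n + 1 - (n + 1)) - baileyCert q 0 (n + 1 - 0) := by
        simp [baileyCert]
      rw [h0, ← Finset.sum_range_sub fun r => baileyCert q r (n + 1 - r)]
      refine Finset.sum_congr rfl fun r hr => ?_
      obtain ⟨d, rfl⟩ := Nat.exists_eq_add_of_le (Nat.lt_succ_iff.1 (Finset.mem_range.1 hr))
      rw [show r + d + 1 - r = d + 1 by omega, show r + d - r = d by omega,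
        show r + d + 1 - (r + 1) = d by omega, show r + d + 1 + r + 2 = d + 2 * r + 3 by omega,
        show r + d + r + 2 = d + 2 * r + 2 by omega]
      exact baileyAlpha_telescoping hq r d
    rw [Finset.sum_range_succ, Nat.sub_self, qPoch_self_succ q n]
    have h3 := qPoch_self_ne_zero hq (2 * n + 3)
    have h4 := one_sub_pow_succ_ne_zero hq (2 * n + 3)
    -- The new top term $r=n+1$, which has no counterpart at level $n$, cancels the upper boundary
    -- value.
    have hlast : (1 - q ^ (n + 1)) * (baileyAlpha q (n + 1) /
        (qPoch q q 0 * qPoch q q (n + 1 + (n + 1) + 2))) = -baileyCert q (n + 1) 0 := by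
      unfold baileyAlpha baileyCert
      rw [show n + 1 + (n + 1) + 2 = 2 * n + 3 + 1 by ring, qPoch_self_succ q (2 * n + 3),
        show 0 + 2 * (n + 1) + 1 = 2 * n + 3 by ring, show 2 * (n + 1) + 2 = 2 * n + 3 + 1 by ring,
        qPoch_zero]
      field_simp
    refine mul_left_cancel₀ h2 ?_
    rw [mul_add, hlast]
    have : (1 - q ^ (n + 1)) * (1 / (qPoch q q n * (1 - q ^ (n + 1)))) = 1 / qPoch q q n := by
      field_simp
    rw [this]
    linear_combination htel

theorem sum_baileyAlpha (hq : ‖q‖ < 1) (n : ℕ) :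
    ∑ p ∈ Finset.HasAntidiagonal.antidiagonal n,
      baileyAlpha q p.1 / (qPoch q q p.2 * qPoch q q (p.2 + 2 * p.1 + 2)) = 1 / qPoch q q n := by
  rw [Finset.Nat.sum_antidiagonal_eq_sum_range_succ_mk, ← sum_baileyAlpha_range hq n]
  refine Finset.sum_congr rfl fun r hr => ?_
  have := Finset.mem_range.1 hr
  rw [show n - r + 2 * r + 2 = n + r + 2 by omega]

theorem norm_baileyAlpha_le (hq : ‖q‖ < 1) (r : ℕ) : ‖baileyAlpha q r‖ ≤ 4 := by
  have h : ∀ n : ℕ, ‖1 - q ^ n‖ ≤ 2 := fun n =>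
    (norm_sub_le _ _).trans (by rw [norm_one]; linarith [norm_pow_le_one hq n])
  have h1 := norm_pow_le_one hq (3 * (r + 1).choose 2)
  rw [baileyAlpha, norm_mul, norm_mul, norm_mul]
  have h0 : ‖(-1 : ℂ) ^ r‖ ≤ 1 := by simp
  have h2 := h (2 * r + 2)
  have h3 := h (r + 1)
  calc ‖(-1 : ℂ) ^ r‖ * ‖q ^ (3 * (r + 1).choose 2)‖ * ‖1 - q ^ (2 * r + 2)‖ * ‖1 - q ^ (r + 1)‖
      ≤ 1 * 1 * 2 * 2 := by gcongr
    _ = 4 := by norm_num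

/-- The Bailey transform for the pair of `sum_baileyAlpha`. -/
theorem bailey_transform (hq : ‖q‖ < 1) {w : ℕ → ℂ} {C : ℝ} (hw : ∀ n, ‖w n‖ ≤ C * ‖q‖ ^ n) :
    HasSum (fun r => baileyAlpha q r *
        ∑' m : ℕ, w (r + m) / (qPoch q q m * qPoch q q (m + 2 * r + 2)))
      (∑' n, w n / qPoch q q n) := by
  obtain ⟨K, hK1, hK⟩ := exists_norm_inv_qPoch_self_le hq
  have hC : 0 ≤ C := by simpa using (norm_nonneg _).trans (hw 0)
  set U : ℕ × ℕ → ℂ := fun p =>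
    baileyAlpha q p.1 * (w (p.1 + p.2) / (qPoch q q p.2 * qPoch q q (p.2 + 2 * p.1 + 2))) with hU
  have hgeo := summable_geometric_of_lt_one (norm_nonneg q) hq
  -- The bound on `w` at $r+m$ splits as $|q|^r|q|^m$, so a product of two geometric series
  -- dominates.
  have hUs : Summable U := by
    refine Summable.of_norm_bounded ((hgeo.mul_of_nonneg hgeo (fun _ => by positivity)
      (fun _ => by positivity)).mul_left (4 * (C * (K * K)))) fun p => ?_
    have e1 := norm_baileyAlpha_le hq p.1
    have e2 := hw (p.1 + p.2)
    have e3 := hK p.2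
    have e4 := hK (p.2 + 2 * p.1 + 2)
    rw [hU]
    simp only
    rw [div_eq_mul_inv, mul_inv, norm_mul, norm_mul, norm_mul]
    calc _ ≤ 4 * (C * ‖q‖ ^ (p.1 + p.2) * (K * K)) := by gcongr
      _ = _ := by rw [pow_add]; ring
  have hsum : ∑' p, U p = ∑' n, w n / qPoch q q n := by
    have hσ : Summable fun c => U (Finset.HasAntidiagonal.sigmaAntidiagonalEquivProd c) :=
      Finset.HasAntidiagonal.sigmaAntidiagonalEquivProd.summable_iff.2 hUs
    rw [← Finset.HasAntidiagonal.sigmaAntidiagonalEquivProd.tsum_eq U,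
      hσ.tsum_sigma' fun n => (hasSum_fintype _).summable]
    refine tsum_congr fun n => ?_
    rw [tsum_fintype, Finset.sum_coe_sort_eq_attach]
    refine (Finset.sum_attach (Finset.HasAntidiagonal.antidiagonal n) U).trans ?_
    rw [div_eq_mul_one_div, ← sum_baileyAlpha hq n, Finset.mul_sum]
    refine Finset.sum_congr rfl fun p hp => ?_
    rw [hU]
    simp only
    rw [Finset.HasAntidiagonal.mem_antidiagonal.1 hp]
    ring
  rw [← hsum]
  have h := hUs.hasSum.prod_fiberwise fun r => (hUs.prod_factor r).hasSum
  simpa only [hU, tsum_mul_left] using h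

/-! ### Inner sums as Warnaar series. -/

/-- The part of the left-hand side that remains after clearing infinite products. -/
noncomputable def clearedTerm (q a : ℂ) (n : ℕ) : ℂ :=
  qPoch q q (2 * n + 1) * q ^ n * qPochInf (a * q ^ (n + 1)) q * qPochInf (q ^ (n + 2) / a) q

theorem exists_norm_clearedTerm_le (hq : ‖q‖ < 1) (a : ℂ) :
    ∃ C : ℝ, ∀ n, ‖clearedTerm q a n‖ ≤ C * ‖q‖ ^ n := by
  obtain ⟨K, hK1, hK⟩ := exists_norm_qPoch_le hq (max ‖q‖ (max ‖a‖ ‖1 / a‖))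
  refine ⟨K * K * K, fun n => ?_⟩
  have e1 := (hK q (by simp)).1 (2 * n + 1)
  have e2 := (hK (a * q ^ (n + 1)) ((norm_mul_pow_le hq a _).trans (by simp))).2
  have e3 := (hK (1 / a * q ^ (n + 2)) ((norm_mul_pow_le hq (1 / a) _).trans (by simp))).2
  rw [clearedTerm, show q ^ (n + 2) / a = 1 / a * q ^ (n + 2) by ring, norm_mul, norm_mul,
    norm_mul, norm_pow]
  calc _ ≤ K * ‖q‖ ^ n * K * K := by gcongr
    _ = _ := by ring

/-- The term $m=0$ supplies the leading product of `warnaarSum` and the terms $m+1$ its kernel; the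
factor $1-q^{2r+2}$ of `baileyAlpha` is exactly $1-ab/q$ at the shifted arguments. -/
theorem baileyAlpha_mul_tsum_clearedTerm (hq0 : q ≠ 0) (hq : ‖q‖ < 1) {a : ℂ} (ha : a ≠ 0)
    (r : ℕ) :
    baileyAlpha q r *
        ∑' m : ℕ, clearedTerm q a (r + m) / (qPoch q q m * qPoch q q (m + 2 * r + 2)) =
      (-1) ^ r * q ^ (3 * (r + 1).choose 2 + r) * (1 - q ^ (r + 1)) *
        warnaarSum q (a * q ^ (r + 1)) (q ^ (r + 2) / a) := by
  have hab : a * q ^ (r + 1) * (q ^ (r + 2) / a) = q ^ (2 * r + 3) := by field_simp; ring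
  have h2 := one_sub_pow_succ_ne_zero hq (2 * r + 1)
  set t : ℕ → ℂ := fun m =>
    clearedTerm q a (r + m) / (qPoch q q m * qPoch q q (m + 2 * r + 2)) with ht
  have ht0 : (1 - q ^ (2 * r + 2)) * t 0 =
      q ^ r * (qPochInf (a * q ^ (r + 1)) q * qPochInf (q ^ (r + 2) / a) q) := by
    have h1 := qPoch_self_ne_zero hq (2 * r + 1)
    simp only [ht, clearedTerm, add_zero, zero_add, qPoch_zero, one_mul]
    rw [qPoch_self_succ q (2 * r + 1)]
    field_simp
  have ht1 : ∀ m, t (m + 1) = q ^ r * (warnaarCoeff q (q ^ (2 * r + 3)) m *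
      qPochInf (a * q ^ (r + 1) * q ^ (m + 1)) q *
      qPochInf (q ^ (r + 2) / a * q ^ (m + 1)) q) := by
    intro m
    have h1 := qPoch_self_ne_zero hq (m + 2 * r + 3)
    have h3 := qPoch_self_ne_zero hq (m + 1)
    have e : qPoch q q (2 * (r + (m + 1)) + 1) =
        qPoch q q (m + 2 * r + 3) * qPoch (q ^ (2 * r + 3) * q ^ (m + 1)) q m := by
      rw [show 2 * (r + (m + 1)) + 1 = m + 2 * r + 3 + m by ring, qPoch_add]
      ring_nf
    simp only [ht, clearedTerm, warnaarCoeff]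
    rw [e, show m + 1 + 2 * r + 2 = m + 2 * r + 3 by ring,
      show a * q ^ (r + (m + 1) + 1) = a * q ^ (r + 1) * q ^ (m + 1) by ring,
      show q ^ (r + (m + 1) + 2) / a = q ^ (r + 2) / a * q ^ (m + 1) by ring]
    field_simp
    ring
  have hs : Summable fun m => t (m + 1) := by
    simp only [ht1]
    exact (summable_warnaar hq (q ^ (2 * r + 3)) (a * q ^ (r + 1)) (q ^ (r + 2) / a) 1 1).mul_left _
  rw [((summable_nat_add_iff 1).1 hs).tsum_eq_zero_add]
  simp only [ht1, tsum_mul_left]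
  unfold baileyAlpha warnaarSum
  rw [hab, show q ^ (2 * r + 3) / q = q ^ (2 * r + 2) by field_simp; ring]
  rw [pow_add q _ r]
  linear_combination (-1) ^ r * q ^ (3 * (r + 1).choose 2) * (1 - q ^ (r + 1)) * ht0

/-! ### Bilateral theta series and the pentagonal number theorem. -/

theorem two_mul_int_choose (m : ℤ) : 2 * (m * (m - 1) / 2) = m * (m - 1) :=
  Int.two_mul_ediv_two_of_even (Int.even_mul_pred_self m)

theorem two_mul_nat_choose (n : ℕ) : 2 * (n.choose 2 : ℤ) = n * (n - 1) := by
  induction n with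
  | zero => simp
  | succ n ih =>
    rw [Nat.choose_succ_succ' n 1, Nat.choose_one_right]; push_cast; linarith

/-- Absolute convergence of the bilateral theta series. -/
theorem summable_norm_zpow_mul_zpow (hq : ‖q‖ < 1) {x : ℂ} (hx : x ≠ 0) :
    Summable fun m : ℤ => ‖x ^ m * q ^ (m * (m - 1) / 2)‖ := by
  refine Summable.of_nat_of_neg_add_one ?_ ?_
  · refine (summable_norm_pow_mul_pow_choose hq x).congr fun n => ?_
    have h : (n : ℤ) * (n - 1) / 2 = (n.choose 2 : ℕ) := by
      have h1 := two_mul_int_choose n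
      have h2 := two_mul_nat_choose n
      omega
    rw [h, zpow_natCast, zpow_natCast]
  · refine ((summable_norm_pow_mul_pow_choose hq (q ^ 2 / x)).mul_left ‖q / x‖).congr fun n => ?_
    have h : -((n : ℤ) + 1) * (-((n : ℤ) + 1) - 1) / 2 = ((n.choose 2 + 2 * n + 1 : ℕ) : ℤ) := by
      have h1 := two_mul_int_choose (-((n : ℤ) + 1))
      have h2 := two_mul_nat_choose n
      have h3 : -((n : ℤ) + 1) * (-((n : ℤ) + 1) - 1) = n * (n - 1) + 4 * n + 2 := by ring
      push_cast
      omega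
    rw [h, zpow_natCast, zpow_neg, ← norm_mul]
    congr 1
    rw [show (n : ℤ) + 1 = ((n + 1 : ℕ) : ℤ) by push_cast; ring, zpow_natCast, div_pow]
    field_simp
    ring

/-- The bilateral series `∑ (-1)^s q^(s(3s-1)/2) y^s`. -/
noncomputable def pentTheta (q y : ℂ) : ℂ := ∑' s : ℤ, (-1) ^ s * q ^ pentagonal s * y ^ s

/-- Since `pentagonal s` is $s+3\binom s2$, this is a theta series in base $q^3$. -/
theorem summable_pentTheta (hq0 : q ≠ 0) (hq : ‖q‖ < 1) {y : ℂ} (hy : y ≠ 0) :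
    Summable fun s : ℤ => (-1) ^ s * q ^ pentagonal s * y ^ s := by
  have hq3 : ‖q ^ 3‖ < 1 := by
    rw [norm_pow]; exact pow_lt_one₀ (norm_nonneg q) hq three_ne_zero
  have h := (summable_norm_zpow_mul_zpow hq3 (x := -1 * q * y)
    (by simp [hq0, hy])).of_norm
  refine h.congr fun s => ?_
  have h1 := two_mul_int_choose s
  have h2 := two_mul_natCast_pentagonal s
  have h3 : (pentagonal s : ℤ) = s + 3 * (s * (s - 1) / 2) := by
    have : s * (3 * s - 1) = 3 * (s * (s - 1)) + 2 * s := by ring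
    omega
  rw [← zpow_natCast q (pentagonal s), h3, zpow_add₀ hq0, zpow_mul, mul_zpow, mul_zpow]
  norm_cast
  ring

/-- Reversal $s\mapsto-s$ raises the pentagonal exponent by $s$. -/
theorem pentTheta_div (hq0 : q ≠ 0) (y : ℂ) : pentTheta q (q / y) = pentTheta q y := by
  unfold pentTheta
  rw [← (Equiv.neg ℤ).tsum_eq]
  refine tsum_congr fun s => ?_
  have h1 := two_mul_natCast_pentagonal s
  have h2 := two_mul_natCast_pentagonal_neg s
  have h3 : (pentagonal (-s) : ℤ) = pentagonal s + s := by
    have : s * (3 * s + 1) = s * (3 * s - 1) + 2 * s := by ring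
    omega
  simp only [Equiv.neg_apply]
  rw [← zpow_natCast q (pentagonal (-s)), h3, zpow_add₀ hq0, zpow_natCast, div_zpow, zpow_neg,
    zpow_neg, zpow_neg, ← inv_zpow]
  have h4 := zpow_ne_zero s hq0
  rw [inv_neg_one]
  field_simp

theorem pentTheta_mul_cube (hq0 : q ≠ 0) {y : ℂ} (hy : y ≠ 0) :
    q * y * pentTheta q (y * q ^ 3) = -pentTheta q y := by
  unfold pentTheta
  rw [← (Equiv.addRight (1 : ℤ)).tsum_eq fun s : ℤ => (-1) ^ s * q ^ pentagonal s * y ^ s,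
    ← tsum_mul_left, ← tsum_neg]
  refine tsum_congr fun s => ?_
  have h1 := two_mul_natCast_pentagonal s
  have h2 := two_mul_natCast_pentagonal (s + 1)
  have h3 : (pentagonal (s + 1) : ℤ) = pentagonal s + 3 * s + 1 := by
    have : (s + 1) * (3 * (s + 1) - 1) = s * (3 * s - 1) + 6 * s + 2 := by ring
    omega
  simp only [Equiv.coe_addRight]
  rw [← zpow_natCast q (pentagonal (s + 1)), h3, zpow_add₀ hq0, zpow_add₀ hq0, zpow_natCast,
    mul_zpow, zpow_add₀ hy, zpow_add₀ (by norm_num : (-1 : ℂ) ≠ 0), zpow_mul]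
  norm_cast
  push_cast
  ring

theorem pentTheta_mul_pow (hq0 : q ≠ 0) {y : ℂ} (hy : y ≠ 0) (k : ℕ) :
    (q * y) ^ k * q ^ (3 * k.choose 2) * pentTheta q (y * q ^ (3 * k)) =
      (-1) ^ k * pentTheta q y := by
  induction k with
  | zero => simp
  | succ k ih =>
    have h := pentTheta_mul_cube hq0 (mul_ne_zero hy (pow_ne_zero (3 * k) hq0))
    rw [pow_succ (-1 : ℂ), Nat.choose_succ_succ' k 1, Nat.choose_one_right,
      show y * q ^ (3 * (k + 1)) = y * q ^ (3 * k) * q ^ 3 by ring]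
    linear_combination (-1) * ih + (q * y) ^ k * q ^ (3 * k.choose 2) * h

/-- Reflection identifies the values at $q^2$ and $q^{-1}$, while the quasi-period makes them
opposite. -/
theorem pentTheta_sq (hq0 : q ≠ 0) : pentTheta q (q ^ 2) = 0 := by
  have h1 := pentTheta_mul_cube hq0 (inv_ne_zero hq0)
  have h2 := pentTheta_div hq0 (q ^ 2)
  rw [show q / q ^ 2 = q⁻¹ by field_simp] at h2
  rw [show q⁻¹ * q ^ 3 = q ^ 2 by field_simp, mul_inv_cancel₀ hq0, h2] at h1
  linear_combination h1 / 2

theorem pentTheta_self (hq0 : q ≠ 0) : pentTheta q q = pentTheta q 1 := by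
  simpa using pentTheta_div hq0 1

/-- Euler's pentagonal number theorem. -/
theorem pentTheta_one (hq0 : q ≠ 0) (hq : ‖q‖ < 1) : pentTheta q 1 = qPochInf q q := by
  have hnil : Tendsto (fun n : ℕ => q ^ n) atTop (𝓝 0) :=
    tendsto_pow_atTop_nhds_zero_of_norm_lt_one hq
  have hs := summable_pentTheta hq0 hq one_ne_zero
  simp only [one_zpow, mul_one] at hs
  have hs' := (Equiv.neg ℤ).summable_iff.2 hs
  obtain ⟨C, hC1, hC⟩ := exists_norm_qPoch_le hq 1
  have hprod : ∀ k n : ℕ, ∏ i ∈ Finset.range (n + 1), (1 - q ^ (k + i + 1)) =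
      qPoch (q ^ (k + 1)) q (n + 1) := fun k n =>
    Finset.prod_congr rfl fun i _ => by rw [← pow_add]; ring_nf
  have hbound : ∀ k n : ℕ,
      ‖q ^ ((k + 1) * n) * ∏ i ∈ Finset.range (n + 1), (1 - q ^ (k + i + 1))‖ ≤ C * ‖q‖ ^ n := by
    intro k n
    have h1 := (hC (q ^ (k + 1)) (norm_pow_le_one hq _)).1 (n + 1)
    have h2 : ‖q‖ ^ ((k + 1) * n) ≤ ‖q‖ ^ n :=
      pow_le_pow_of_le_one (norm_nonneg q) hq.le (Nat.le_mul_of_pos_left n k.succ_pos)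
    rw [hprod, norm_mul, norm_pow, mul_comm C]
    gcongr
  -- The $k$th pair of the pentagonal series consists of the indices $-k$ and $k+1$; after negating
  -- the summation index these are the two halves of $\mathbb Z$.
  have hterm : ∀ k : ℕ, (-1 : ℂ) ^ k * (q ^ pentagonal (-k) - q ^ pentagonal (k + 1)) =
      (-1 : ℂ) ^ (-(k : ℤ)) * q ^ pentagonal (-(k : ℤ)) +
        (-1 : ℂ) ^ (-(-((k : ℤ) + 1))) * q ^ pentagonal (-(-((k : ℤ) + 1))) := by
    intro k
    rw [neg_neg, zpow_neg, ← inv_zpow, inv_neg_one, zpow_add₀ (by norm_num), zpow_natCast, zpow_one]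
    ring
  have hp := hs'.comp_injective Nat.cast_injective
  have hn := hs'.comp_injective (i := fun k : ℕ => -((k : ℤ) + 1))
    (fun a b h => by simpa using h)
  have main := Pentagonal.tprod_one_sub_pow (x := q) hnil
    (fun k => summable_of_norm_le_mul_pow hq (hbound k))
    (fun k => by
      refine (hasProd_qPochInf (q ^ (k + 1)) q hq).multipliable.congr fun n => ?_
      rw [← pow_add]; ring_nf)
    (by
      simp only [hterm]
      exact hp.add hn)
    (by
      have h0 : Tendsto (fun k : ℕ => ‖q‖ ^ k * (C * (1 - ‖q‖)⁻¹)) atTop (𝓝 0) := by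
        simpa using (tendsto_pow_atTop_nhds_zero_of_lt_one (norm_nonneg q) hq).mul_const
          (C * (1 - ‖q‖)⁻¹)
      refine squeeze_zero_norm (fun k => ?_) h0
      rw [norm_mul, norm_mul, norm_pow, norm_pow, norm_neg, norm_one, one_pow, one_mul]
      have hk : k ≤ (k + 1) * (3 * k + 4) / 2 := by
        rw [Nat.le_div_iff_mul_le two_pos]; nlinarith
      exact mul_le_mul (pow_le_pow_of_le_one (norm_nonneg q) hq.le hk)
        (tsum_of_norm_bounded ((hasSum_geometric_of_lt_one (norm_nonneg q) hq).mul_left C)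
          (hbound k)) (norm_nonneg _) (by positivity))
  have hP : qPochInf q q = ∏' n : ℕ, (1 - q ^ (n + 1)) := by
    unfold qPochInf; simp only [pow_succ']
  unfold pentTheta
  simp only [one_zpow, mul_one]
  rw [hP, main, ← (Equiv.neg ℤ).tsum_eq, tsum_of_nat_of_neg_add_one
    (f := fun s => (-1 : ℂ) ^ (Equiv.neg ℤ) s * q ^ pentagonal ((Equiv.neg ℤ) s)) hp hn]
  simp only [hterm]
  exact (hp.tsum_add hn).symm

/-! ### Interchange of the pentagonal and partial theta sums. -/

/-- The exponent equals $\binom{s+n}2+s+2\binom s2$, so $(s,n)\mapsto(s+n,s)$ embeds the family into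
a product of two absolutely convergent theta series, in bases $q$ and $q^2$. -/
theorem summable_pentTheta_partialTheta (hq0 : q ≠ 0) (hq : ‖q‖ < 1) {x y : ℂ} (hx : x ≠ 0)
    (hy : y ≠ 0) : Summable fun p : ℤ × ℕ =>
      (-1) ^ p.1 * q ^ pentagonal p.1 * y ^ p.1 * ((-(x * q ^ p.1)) ^ p.2 * q ^ p.2.choose 2) := by
  have hq2 : ‖q ^ 2‖ < 1 := by
    rw [norm_pow]; exact pow_lt_one₀ (norm_nonneg q) hq two_ne_zero
  have h1 := summable_norm_zpow_mul_zpow hq (neg_ne_zero.2 hx)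
  have h2 := summable_norm_zpow_mul_zpow hq2 (x := -1 * y * q / -x)
    (div_ne_zero (by simp [hq0, hy]) (neg_ne_zero.2 hx))
  have h3 := summable_mul_of_summable_norm h1 h2
  have hinj : Function.Injective fun p : ℤ × ℕ => ((p.1 + p.2, p.1) : ℤ × ℤ) := by
    rintro ⟨s, n⟩ ⟨s', n'⟩ h
    simp only [Prod.mk.injEq] at h ⊢
    omega
  refine (h3.comp_injective hinj).congr fun p => ?_
  obtain ⟨s, n⟩ := p
  have e1 := two_mul_int_choose s
  have e2 := two_mul_natCast_pentagonal s
  have e3 := two_mul_int_choose (s + n)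
  have e4 := two_mul_nat_choose n
  have e5 : (pentagonal s : ℤ) + s * n + n.choose 2 =
      (s + n) * (s + n - 1) / 2 + s + 2 * (s * (s - 1) / 2) := by
    have : s * (3 * s - 1) + 2 * (s * n) + n * (n - 1) =
      (s + n) * (s + n - 1) + 2 * s + 2 * (s * (s - 1)) := by ring
    omega
  have e6 : q ^ pentagonal s * q ^ (s * n) * q ^ n.choose 2 =
      q ^ ((s + n) * (s + n - 1) / 2) * q ^ s * (q ^ 2) ^ (s * (s - 1) / 2) := by
    rw [← zpow_natCast q (pentagonal s), ← zpow_natCast q (n.choose 2), ← zpow_natCast q 2,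
      ← zpow_mul, ← zpow_add₀ hq0, ← zpow_add₀ hq0, ← zpow_add₀ hq0, ← zpow_add₀ hq0, e5]
    rfl
  have hx' := zpow_ne_zero s (neg_ne_zero.2 hx)
  simp only [Function.comp_apply]
  rw [zpow_add₀ (neg_ne_zero.2 hx), div_zpow, mul_zpow, mul_zpow, zpow_natCast,
    neg_mul_eq_neg_mul, mul_pow, ← zpow_natCast (q ^ s) n, ← zpow_mul]
  field_simp
  linear_combination (-(-x) ^ n) * e6

/-- Interchanging summations between the pentagonal series and partial theta functions. -/
theorem hasSum_pentTheta_partialTheta (hq0 : q ≠ 0) (hq : ‖q‖ < 1) {x y : ℂ} (hx : x ≠ 0)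
    (hy : y ≠ 0) : ∃ l : ℂ,
      HasSum (fun s : ℤ => (-1) ^ s * q ^ pentagonal s * y ^ s * partialTheta q (x * q ^ s)) l ∧
      HasSum (fun n : ℕ => (-x) ^ n * q ^ n.choose 2 * pentTheta q (y * q ^ n)) l := by
  have hs := summable_pentTheta_partialTheta hq0 hq hx hy
  refine ⟨∑' p : ℤ × ℕ, (-1) ^ p.1 * q ^ pentagonal p.1 * y ^ p.1 *
    ((-(x * q ^ p.1)) ^ p.2 * q ^ p.2.choose 2), ?_, ?_⟩
  · have h := hs.hasSum.prod_fiberwise fun s => (hs.prod_factor s).hasSum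
    simpa only [tsum_mul_left, partialTheta] using h
  · have hs' := hs.prod_symm
    have h := ((Equiv.prodComm ℕ ℤ).hasSum_iff.2 hs.hasSum).prod_fiberwise
      fun n => (hs'.prod_factor n).hasSum
    have hfun : (fun n : ℕ => (-x) ^ n * q ^ n.choose 2 * pentTheta q (y * q ^ n)) =
        fun n : ℕ => ∑' s : ℤ, (-1) ^ s * q ^ pentagonal s * y ^ s *
          ((-(x * q ^ s)) ^ n * q ^ n.choose 2) := by
      ext n
      unfold pentTheta
      rw [← tsum_mul_left]
      refine tsum_congr fun s => ?_
      rw [neg_mul_eq_neg_mul, mul_pow, mul_zpow, ← zpow_natCast (q ^ s) n, ← zpow_natCast q n,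
        ← zpow_mul, ← zpow_mul, mul_comm s]
      ring
    rw [hfun]
    exact h

theorem HasSum.of_forall_eq {ι : Type*} {f g : ι → ℂ} {l : ℂ} (h : HasSum g l)
    (hfg : ∀ i, f i = g i) : HasSum f l := (funext hfg : f = g) ▸ h

/-! ### Evaluation of the remaining sums and conclusion. -/

theorem theta_quasi_periodic (hq0 : q ≠ 0) (hq : ‖q‖ < 1) {a : ℂ} (ha : a ≠ 0) (s : ℕ) :
    q ^ (s + 1).choose 2 * (qPochInf (a / q ^ s) q * qPochInf (q ^ (s + 1) / a) q) =
      (-a) ^ s * (qPochInf a q * qPochInf (q / a) q) := by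
  induction s with
  | zero => simp
  | succ s ih =>
    have h1 : qPochInf (a / q ^ (s + 1)) q = (1 - a / q ^ (s + 1)) * qPochInf (a / q ^ s) q := by
      rw [qPochInf_eq_one_sub_mul hq (a / q ^ (s + 1)),
        show a / q ^ (s + 1) * q = a / q ^ s by rw [pow_succ]; field_simp]
    have h2 : qPochInf (q ^ (s + 1) / a) q =
        (1 - q ^ (s + 1) / a) * qPochInf (q ^ (s + 1 + 1) / a) q := by
      rw [qPochInf_eq_one_sub_mul hq (q ^ (s + 1) / a),
        show q ^ (s + 1) / a * q = q ^ (s + 1 + 1) / a by ring]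
    have h3 : q ^ (s + 1) * (1 - a / q ^ (s + 1)) = -a * (1 - q ^ (s + 1) / a) := by
      field_simp
      ring
    rw [h2] at ih
    rw [h1, Nat.choose_succ_succ' (s + 1) 1, Nat.choose_one_right, pow_succ (-a), pow_add]
    linear_combination (-a) * ih + q ^ (s + 1).choose 2 * qPochInf (a / q ^ s) q *
      qPochInf (q ^ (s + 1 + 1) / a) q * h3

/-- The summand of the partial theta series on the left-hand side. -/
noncomputable def falseThetaTerm (q a : ℂ) (n : ℕ) : ℂ :=
  a ^ (n + 1) * q ^ ((n : ℤ) ^ 2 + (n : ℤ) - 1) * (1 - q ^ (n + 1))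

/-- The summand of the series on the right-hand side. -/
noncomputable def cubicTerm (q a : ℂ) (n : ℕ) : ℂ :=
  a ^ (3 * n) * q ^ (3 * (n : ℤ) ^ 2 - 2 * (n : ℤ) - 1) * (1 - a * q ^ (2 * n)) *
    (1 - q ^ n + a * q ^ (2 * n))

/-- The integer exponent is $-1$ at $n=0$; one extra factor $q$ brings it back to natural powers. -/
theorem q_mul_zpow_sq_add (hq0 : q ≠ 0) (n : ℕ) :
    q * q ^ ((n : ℤ) ^ 2 + (n : ℤ) - 1) = q ^ (2 * n.choose 2 + 2 * n) := by
  have h := two_mul_nat_choose n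
  rw [← zpow_one_add₀ hq0, ← zpow_natCast]
  congr 1
  push_cast
  linear_combination -h

theorem q_mul_zpow_cubic (hq0 : q ≠ 0) (n : ℕ) :
    q * q ^ (3 * (n : ℤ) ^ 2 - 2 * (n : ℤ) - 1) = q ^ (6 * n.choose 2 + n) := by
  have h := two_mul_nat_choose n
  rw [← zpow_one_add₀ hq0, ← zpow_natCast]
  congr 1
  push_cast
  linear_combination (-3) * h

theorem summable_falseThetaTerm (hq0 : q ≠ 0) (hq : ‖q‖ < 1) (a : ℂ) :
    Summable (falseThetaTerm q a) := by
  have hq2 : ‖q ^ 2‖ < 1 := by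
    rw [norm_pow]; exact pow_lt_one₀ (norm_nonneg q) hq two_ne_zero
  have h1 := (summable_norm_pow_mul_pow_choose hq2 (a * q ^ 2)).of_norm
  have h2 := (summable_norm_pow_mul_pow_choose hq2 (a * q ^ 3)).of_norm
  refine ((h1.mul_left (a / q)).sub (h2.mul_left a)).congr fun n => ?_
  have h := q_mul_zpow_sq_add hq0 n
  refine mul_left_cancel₀ hq0 ?_
  rw [falseThetaTerm]
  calc _ = a ^ (n + 1) * q ^ (2 * n.choose 2 + 2 * n) * (1 - q ^ (n + 1)) := by
        field_simp; ring
    _ = _ := by rw [← h]; ring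

/-- The triple product at $a/q^{r+1}$ contains the same $\theta(q^{r+2}/a)-1$ as Warnaar's identity,
and `theta_quasi_periodic` reduces its product to $(a,q/a;q)_\infty$. -/
theorem mul_warnaarSum_eq (hq0 : q ≠ 0) (hq : ‖q‖ < 1) {a : ℂ} (ha : a ≠ 0) (r : ℕ) :
    qPochInf q q * ((-1) ^ r * q ^ (3 * (r + 1).choose 2 + r) * (1 - q ^ (r + 1)) *
        warnaarSum q (a * q ^ (r + 1)) (q ^ (r + 2) / a)) =
      (-1) ^ r * q ^ (3 * (r + 1).choose 2 + r) * (1 - q ^ (r + 1)) *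
          (partialTheta q (a * q ^ (r + 1)) - partialTheta q (a / q ^ (r + 1))) -
        qPochInf q q * (qPochInf a q * qPochInf (q / a) q) * falseThetaTerm q a r := by
  have hab : a * q ^ (r + 1) * (q ^ (r + 2) / a) = q * q ^ (2 * r + 1 + 1) := by
    field_simp; ring
  have hne : a * q ^ (r + 1) * (q ^ (r + 2) / a) ≠ q := by
    rw [hab]
    exact fun h => pow_succ_ne_one hq (2 * r + 1) (mul_left_cancel₀ hq0 (by rw [h, mul_one]))
  have h1 := warnaarSum_eq hq0 hq hne
  have hx : a / q ^ (r + 1) ≠ 0 := div_ne_zero ha (pow_ne_zero _ hq0)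
  have h2 := jacobi_triple_product hq hx
  rw [show q / (a / q ^ (r + 1)) = q ^ (r + 1 + 1) / a by field_simp; ring] at h2
  have h3 := theta_quasi_periodic hq0 hq ha (r + 1)
  have h4 : q ^ (3 * (r + 1).choose 2 + r) * (qPochInf (a / q ^ (r + 1)) q *
      qPochInf (q ^ (r + 1 + 1) / a) q) * (-1) ^ r =
      -a ^ (r + 1) * q ^ ((r : ℤ) ^ 2 + (r : ℤ) - 1) * (qPochInf a q * qPochInf (q / a) q) := by
    have h5 := q_mul_zpow_sq_add hq0 r
    have h6 : q * q ^ (3 * (r + 1).choose 2 + r) =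
        q ^ (2 * r.choose 2 + 2 * r) * q ^ (r + 1 + 1).choose 2 := by
      rw [Nat.choose_succ_succ' (r + 1) 1, Nat.choose_succ_succ' r 1, Nat.choose_one_right,
        Nat.choose_one_right]
      ring
    have h7 : (-1 : ℂ) ^ r * (-a) ^ (r + 1) = -a ^ (r + 1) := by
      have h8 : (-1 : ℂ) ^ r * (-1) ^ r = 1 := by rw [← mul_pow]; simp
      rw [neg_pow a, pow_succ (-1 : ℂ)]
      linear_combination (-a ^ (r + 1)) * h8
    refine mul_left_cancel₀ hq0 ?_
    rw [← mul_assoc, ← mul_assoc, h6]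
    rw [show q * (-a ^ (r + 1) * q ^ ((r : ℤ) ^ 2 + (r : ℤ) - 1) *
      (qPochInf a q * qPochInf (q / a) q)) = -a ^ (r + 1) * (qPochInf a q * qPochInf (q / a) q) *
      (q * q ^ ((r : ℤ) ^ 2 + (r : ℤ) - 1)) by ring, h5, ← h7]
    linear_combination q ^ (2 * r.choose 2 + 2 * r) * (-1) ^ r * h3
  rw [falseThetaTerm]
  rw [show r + 1 + 1 = r + 2 by ring] at h2 h4
  linear_combination ((-1) ^ r * q ^ (3 * (r + 1).choose 2 + r) * (1 - q ^ (r + 1))) * h1 -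
    ((-1) ^ r * q ^ (3 * (r + 1).choose 2 + r) * (1 - q ^ (r + 1))) * h2 +
    qPochInf q q * (1 - q ^ (r + 1)) * h4

theorem hasSum_partialTheta_sub (hq0 : q ≠ 0) (hq : ‖q‖ < 1) {a : ℂ} (ha : a ≠ 0) :
    ∃ l : ℂ,
      HasSum (fun r : ℕ => (-1) ^ r * q ^ (3 * (r + 1).choose 2 + r) * (1 - q ^ (r + 1)) *
        (partialTheta q (a * q ^ (r + 1)) - partialTheta q (a / q ^ (r + 1)))) (-l / q) ∧
      HasSum (fun n : ℕ => (-a) ^ n * q ^ n.choose 2 *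
        (pentTheta q (q ^ n) - pentTheta q (q ^ (n + 1)))) l := by
  obtain ⟨l₁, h1, h1'⟩ := hasSum_pentTheta_partialTheta hq0 hq ha one_ne_zero
  obtain ⟨l₂, h2, h2'⟩ := hasSum_pentTheta_partialTheta hq0 hq ha hq0
  refine ⟨l₁ - l₂, ?_, ?_⟩
  -- `g` comes from the bilateral sums at $y=1$ and $y=q$, the second reversed by $s\mapsto-s$.
  · set g : ℤ → ℂ := fun s => (-1) ^ s * q ^ pentagonal s *
      (partialTheta q (a * q ^ s) - partialTheta q (a * q ^ (-s))) with hg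
    have h3 : HasSum g (l₁ - l₂) := by
      refine (h1.sub ((Equiv.neg ℤ).hasSum_iff.2 h2)).of_forall_eq fun s => ?_
      have e1 := two_mul_natCast_pentagonal s
      have e2 := two_mul_natCast_pentagonal_neg s
      have e3 : (pentagonal (-s) : ℤ) = pentagonal s + s := by
        have : s * (3 * s + 1) = s * (3 * s - 1) + 2 * s := by ring
        omega
      have e4 : q ^ pentagonal (-s) * q ^ (-s) = q ^ pentagonal s := by
        rw [← zpow_natCast q (pentagonal (-s)), ← zpow_add₀ hq0, e3, add_neg_cancel_right,
          zpow_natCast]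
      have e5 : (-1 : ℂ) ^ (-s) = (-1) ^ s := by rw [zpow_neg, ← inv_zpow, inv_neg_one]
      simp only [hg, Function.comp_apply, Equiv.neg_apply, one_zpow, mul_one]
      rw [e5]
      linear_combination (-1) ^ s * partialTheta q (a * q ^ (-s)) * e4
    -- Folding $s$ with $-s$ creates the factor $1-q^s$. The index $s=0$ contributes nothing, and
    -- $-1/q$ normalises $s=r+1$.
    have h4 := ((hasSum_nat_add_iff' 1).2 h3.nat_add_neg).mul_left (-1 / q)
    have h0 : g 0 = 0 := by simp [hg]
    have hval : -1 / q * (l₁ - l₂ + g 0 - ∑ i ∈ Finset.range 1, (g (i : ℕ) + g (-(i : ℕ)))) =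
        -(l₁ - l₂) / q := by
      simp [h0]
      ring
    rw [hval] at h4
    refine h4.of_forall_eq fun r => ?_
    · have e1 := two_mul_natCast_pentagonal (r + 1)
      have e2 := two_mul_natCast_pentagonal_neg (r + 1)
      have e3 := two_mul_nat_choose (r + 1)
      have e4 : pentagonal (r + 1) = 3 * (r + 1).choose 2 + r + 1 := by
        have : ((r : ℤ) + 1) * (3 * (r + 1) - 1) = 3 * ((r + 1) * (r + 1 - 1)) + 2 * r + 2 := by
          ring
        push_cast at e3
        omega
      have e5 : pentagonal (-(r + 1)) = 3 * (r + 1).choose 2 + r + 1 + (r + 1) := by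
        have : ((r : ℤ) + 1) * (3 * (r + 1) + 1) =
            3 * ((r + 1) * (r + 1 - 1)) + 2 * r + 2 + 2 * (r + 1) := by
          ring
        push_cast at e3
        omega
      have e6 : (-1 : ℂ) ^ (-((r : ℤ) + 1)) = (-1) ^ (r + 1) := by
        rw [zpow_neg, ← inv_zpow, inv_neg_one]; norm_cast
      have e7 : a * q ^ (-((r : ℤ) + 1)) = a / q ^ (r + 1) := by
        rw [zpow_neg, div_eq_mul_inv]; norm_cast
      have e8 : ∀ x : ℂ, x ^ ((r : ℤ) + 1) = x ^ (r + 1) := fun x => by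
        rw [← Nat.cast_succ, zpow_natCast]
      simp only [hg]
      push_cast
      rw [e4, e5, e6, e7, neg_neg, e8, e8]
      field_simp
      ring
  · refine (h1'.sub h2').of_forall_eq fun n => ?_
    rw [one_mul, ← pow_succ', mul_sub]

/-- As $P(q^{3k+2})=0$ and the other values are monomials times $(q;q)_\infty$, four monomials
survive: those of $(1-aq^{2k})(1-q^k+aq^{2k})=1-q^k+aq^{3k}-a^2q^{4k}$. -/
theorem sum_pentTheta_sub (hq0 : q ≠ 0) (hq : ‖q‖ < 1) (a : ℂ) (k : ℕ) :
    ∑ i : Fin 3, (-a) ^ (k * 3 + i : ℕ) * q ^ (k * 3 + i : ℕ).choose 2 *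
        (pentTheta q (q ^ (k * 3 + i : ℕ)) - pentTheta q (q ^ (k * 3 + i + 1 : ℕ))) =
      -q * qPochInf q q * cubicTerm q a k := by
  have h0 := pentTheta_mul_pow hq0 one_ne_zero k
  have h1 := pentTheta_mul_pow hq0 hq0 k
  have h2 := pentTheta_mul_pow hq0 (pow_ne_zero 2 hq0) k
  have h3 := pentTheta_mul_pow hq0 one_ne_zero (k + 1)
  have h4 := q_mul_zpow_cubic hq0 k
  have h5 : (-1 : ℂ) ^ k * (-1) ^ k = 1 := by rw [← mul_pow]; simp
  have c1 : (3 * k + 1).choose 2 = 9 * k.choose 2 + 6 * k := by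
    have e1 := two_mul_nat_choose k
    have e2 := two_mul_nat_choose (3 * k + 1)
    push_cast at e2
    have : (3 * (k : ℤ) + 1) * (3 * k + 1 - 1) = 9 * (k * (k - 1)) + 12 * k := by ring
    omega
  have c0 : (3 * k).choose 2 = 9 * k.choose 2 + 3 * k := by
    have := Nat.choose_succ_succ' (3 * k) 1
    simp only [Nat.choose_one_right, Nat.reduceAdd] at this
    omega
  have c2 : (3 * k + 2).choose 2 = 9 * k.choose 2 + 9 * k + 1 := by
    have := Nat.choose_succ_succ' (3 * k + 1) 1
    simp only [Nat.choose_one_right, Nat.reduceAdd] at this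
    rw [show 3 * k + 2 = 3 * k + 1 + 1 by ring]
    omega
  rw [pentTheta_sq hq0, mul_zero, mul_eq_zero] at h2
  have h2 : pentTheta q (q ^ 2 * q ^ (3 * k)) = 0 := h2.resolve_left (by simp [hq0])
  rw [pentTheta_self hq0] at h1
  rw [one_mul] at h0 h3
  rw [← pow_add] at h2
  rw [show q * q ^ (3 * k) = q ^ (3 * k + 1) by ring] at h1
  rw [Nat.choose_succ_succ' k 1, Nat.choose_one_right] at h3
  rw [Fin.sum_univ_three]
  simp only [Fin.val_zero, Fin.val_one, Fin.val_two]
  rw [mul_comm k 3, add_zero, c0, c1, c2, show 3 * k + 1 + 1 = 2 + 3 * k by ring, h2,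
    show 2 + 3 * k + 1 = 3 * (k + 1) by ring, show 2 + 3 * k = 3 * k + 2 by ring]
  have h6 : (-a) ^ (3 * k) = (-1) ^ k * a ^ (3 * k) := by
    rw [neg_pow a, pow_mul]; norm_num
  have h7 : cubicTerm q a k * q = a ^ (3 * k) * q ^ (6 * k.choose 2 + k) *
      (1 - a * q ^ (2 * k)) * (1 - q ^ k + a * q ^ (2 * k)) := by
    rw [cubicTerm, ← h4]; ring
  rw [show -q * qPochInf q q * cubicTerm q a k = -qPochInf q q * (cubicTerm q a k * q) by ring, h7,
    pow_add (-a) (3 * k) 1, pow_add (-a) (3 * k) 2, h6]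
  rw [pentTheta_one hq0 hq] at h0 h1 h3
  linear_combination a ^ (3 * k) * (-1) ^ k * q ^ (6 * k.choose 2 + 2 * k) * h0 -
    (a ^ (3 * k) * (-1) ^ k * q ^ (6 * k.choose 2 + k) +
      a ^ (3 * k + 1) * (-1) ^ k * q ^ (6 * k.choose 2 + 4 * k)) * h1 -
    a ^ (3 * k + 2) * (-1) ^ k * q ^ (6 * k.choose 2 + 5 * k) * h3 +
    qPochInf q q * a ^ (3 * k) * (q ^ (6 * k.choose 2 + 2 * k) - q ^ (6 * k.choose 2 + k) -
      a * q ^ (6 * k.choose 2 + 4 * k) + a ^ 2 * q ^ (6 * k.choose 2 + 5 * k)) * h5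

theorem hasSum_cubicTerm (hq0 : q ≠ 0) (hq : ‖q‖ < 1) {a l : ℂ}
    (h : HasSum (fun n : ℕ => (-a) ^ n * q ^ n.choose 2 *
        (pentTheta q (q ^ n) - pentTheta q (q ^ (n + 1)))) l) :
    HasSum (cubicTerm q a) (-l / (q * qPochInf q q)) := by
  have hP := qPochInf_self_ne_zero hq
  have h1 := (Nat.divModEquiv 3).symm.hasSum_iff.2 h
  have h2 := h1.prod_fiberwise fun k => hasSum_fintype _
  simp only [Function.comp_apply, Nat.divModEquiv_symm_apply, sum_pentTheta_sub hq0 hq] at h2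
  have h3 := h2.mul_left (-1 / (q * qPochInf q q))
  rw [show -1 / (q * qPochInf q q) * l = -l / (q * qPochInf q q) by ring] at h3
  exact h3.of_forall_eq fun k => by field_simp

theorem hasSum_cleared (hq0 : q ≠ 0) (hq : ‖q‖ < 1) {a : ℂ} (ha : a ≠ 0) :
    Summable (cubicTerm q a) ∧
      ∑' n, clearedTerm q a n / qPoch q q n = ∑' n, cubicTerm q a n -
        qPochInf a q * qPochInf (q / a) q * ∑' n, falseThetaTerm q a n := by
  have hP := qPochInf_self_ne_zero hq
  obtain ⟨l, h1, h2⟩ := hasSum_partialTheta_sub hq0 hq ha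
  have h3 := hasSum_cubicTerm hq0 hq h2
  obtain ⟨C, hC⟩ := exists_norm_clearedTerm_le hq a
  have h4 := (bailey_transform hq hC).mul_left (qPochInf q q)
  simp only [baileyAlpha_mul_tsum_clearedTerm hq0 hq ha, mul_warnaarSum_eq hq0 hq ha] at h4
  have h5 := h1.sub ((summable_falseThetaTerm hq0 hq a).hasSum.mul_left
    (qPochInf q q * (qPochInf a q * qPochInf (q / a) q)))
  have h6 := h4.unique h5
  refine ⟨h3.summable, mul_left_cancel₀ hP ?_⟩
  rw [h6, h3.tsum_eq]
  field_simp

theorem summand_eq (hq : ‖q‖ < 1) {a : ℂ} (h1 : qPochInf (a * q) q ≠ 0)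
    (h2 : qPochInf (q / a) q ≠ 0) (n : ℕ) :
    qPoch (q ^ (n + 1)) q (n + 1) * q ^ n / (qPoch (a * q) q n * qPoch (q / a) q (n + 1)) =
      1 / (qPochInf (a * q) q * qPochInf (q / a) q) * (clearedTerm q a n / qPoch q q n) := by
  have e1 := qPochInf_eq_mul hq (a * q) n
  have e2 := qPochInf_eq_mul hq (q / a) (n + 1)
  rw [show a * q * q ^ n = a * q ^ (n + 1) by ring] at e1
  rw [show q / a * q ^ (n + 1) = q ^ (n + 2) / a by ring] at e2
  have e3 : qPoch q q (2 * n + 1) = qPoch q q n * qPoch (q ^ (n + 1)) q (n + 1) := by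
    rw [show 2 * n + 1 = n + (n + 1) by ring, qPoch_add, ← pow_succ']
  have h3 := qPoch_self_ne_zero hq n
  rw [e1] at h1
  rw [e2] at h2
  obtain ⟨h4, h5⟩ := mul_ne_zero_iff.1 h1
  obtain ⟨h6, h7⟩ := mul_ne_zero_iff.1 h2
  rw [clearedTerm, e1, e2, e3]
  generalize qPochInf (a * q ^ (n + 1)) q = x at *
  generalize qPochInf (q ^ (n + 2) / a) q = y at *
  field_simp

theorem mainTheorem5 (a q : ℂ) (hq0 : q ≠ 0) (hq1 : ‖q‖ < 1) (ha0 : a ≠ 0)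
    (haq : ∀ m : ℕ, 1 ≤ m → a * q ^ m ≠ 1) (hqa : ∀ m : ℕ, 1 ≤ m → a ≠ q ^ m) :
    Summable (fun n : ℕ =>
      qPoch (q ^ (n + 1)) q (n + 1) * q ^ n / (qPoch (a * q) q n * qPoch (q / a) q (n + 1))) ∧
    Summable (fun n : ℕ =>
      a ^ (n + 1) * q ^ ((n : ℤ) ^ 2 + (n : ℤ) - 1) * (1 - q ^ (n + 1))) ∧
    Summable (fun n : ℕ =>
      a ^ (3 * n) * q ^ (3 * (n : ℤ) ^ 2 - 2 * (n : ℤ) - 1) * (1 - a * q ^ (2 * n)) *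
        (1 - q ^ n + a * q ^ (2 * n))) ∧
    (∑' n : ℕ,
        qPoch (q ^ (n + 1)) q (n + 1) * q ^ n / (qPoch (a * q) q n * qPoch (q / a) q (n + 1))) +
      (1 - a) * ∑' n : ℕ,
        a ^ (n + 1) * q ^ ((n : ℤ) ^ 2 + (n : ℤ) - 1) * (1 - q ^ (n + 1)) =
    1 / (qPochInf (a * q) q * qPochInf (q / a) q) *
      ∑' n : ℕ,
        a ^ (3 * n) * q ^ (3 * (n : ℤ) ^ 2 - 2 * (n : ℤ) - 1) * (1 - a * q ^ (2 * n)) *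
          (1 - q ^ n + a * q ^ (2 * n)) := by
  have h1 : qPochInf (a * q) q ≠ 0 := qPochInf_ne_zero hq1 fun k => by
    rw [mul_assoc, ← pow_succ']; exact haq _ k.succ_pos
  have h2 : qPochInf (q / a) q ≠ 0 := qPochInf_ne_zero hq1 fun k h => by
    refine hqa (k + 1) k.succ_pos ?_
    field_simp at h
    rw [pow_succ', h]
  obtain ⟨h3, h4⟩ := hasSum_cleared hq0 hq1 ha0
  have h5 : Summable fun n => clearedTerm q a n / qPoch q q n := by
    obtain ⟨C, hC⟩ := exists_norm_clearedTerm_le hq1 a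
    obtain ⟨K, hK1, hK⟩ := exists_norm_inv_qPoch_self_le hq1
    refine summable_of_norm_le_mul_pow hq1 (C := C * K) fun n => ?_
    have e1 := hC n
    have e2 := hK n
    rw [div_eq_mul_inv, norm_mul]
    calc _ ≤ C * ‖q‖ ^ n * K := by gcongr; exact (norm_nonneg _).trans e1
      _ = _ := by ring
  simp only [summand_eq hq1 h1 h2]
  refine ⟨h5.mul_left _, summable_falseThetaTerm hq0 hq1 a, h3, ?_⟩
  -- Splitting off the first factor of $(a;q)_\infty$ produces the coefficient $1-a$ of the second
  -- series.
  rw [tsum_mul_left, h4, qPochInf_eq_one_sub_mul hq1 a]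
  simp only [falseThetaTerm, cubicTerm]
  field_simp
  ring
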